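/- **Theorem.** The following holds (in ZFC): $$\mathfrak q_0\le\mathrm{non}(\widetilde{\mathcal I}_{cccc})\le\min\{\mathfrak b,\mathrm{non}(\mathcal I_{ccc})\}\le\min\{\mathfrak b,\mathrm{non}(\mathcal N)\}=\min\{\mathfrak b,\mathrm{non}(\mathcal E)\}.$$ Here the notation is as follows. A *$\sigma$-ideal* on a set $X$ is a family $\mathcal I$ of subsets of $X$ such that $\bigcup\mathcal I=X\notin\mathcal I$ and, for each countable subfamily $\mathcal A\subset\mathcal I$, each subset of $\bigcup\mathcal A$ belongs to $\mathcal I$. For a family $\mathcal I$ of subsets of $X$, $\mathrm{non}(\mathcal I)$ is the smallest cardinality of a subset of $X$ that does not belong to $\mathcal I$. An *automorphism* of $\mathcal I$ is a bijection $f:X\to X$ with $\{f(A):A\in\mathcal I\}=\mathcal I$. The $\sigma$-ideal $\mathcal I$ is *flexible* if for any $A,B\subset X$ with $|A\cup B|<|X|$ there is an automorphism $f$ of $\mathcal I$ with $f(A)\cap B=\emptyset$. If $X$ is a topological space, $\mathcal I$ is *cccc* (respectively *ccc*) if every uncountable disjoint family of compact (respectively Borel) subsets of $X$ has a member that belongs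 to $\mathcal I$; and $\mathcal I$ has a *Borel base* if each $A\in\mathcal I$ is contained in a Borel set $B\in\mathcal I$. A $\sigma$-ideal $\mathcal I$ on an abelian group $G$ is *invariant* if $\{g+A:A\in\mathcal I\}=\mathcal I$ for every $g\in G$. * $\mathfrak q_0$ is the smallest cardinality of a set $X\subset\mathbb R$ that is not a $Q$-set, where $X$ is a *$Q$-set* if every subset of $X$ is an $F_\sigma$-set in the subspace $X$. * $\mathfrak b$ is the smallest cardinality of a subset of the Baire space $\omega^\omega$ that is not contained in a $\sigma$-compact subset of $\omega^\omega$. * $\widetilde{\mathcal I}_{cccc}$ is the intersection of all flexible cccc $\sigma$-ideals on $\mathbb R$. * $\mathcal I_{ccc}$ is the intersection of all invariant ccc $\sigma$-ideals with Borel base on the compact group $\mathbb Z_2^\omega=2^\omega$. * $\mathcal N$ is the ideal of Lebesgue null subsets of $\mathbb R$, and $\mathcal E$ is the $\sigma$-ideal on $\mathbb R$ generated by the closed Lebesgue null sets, i.e. the family of all sets that can be covered by countably many closed null sets. -/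

import Mathlib

open scoped Cardinal MeasureTheory

/-- A set of type `F_σ`: a countable union of closed sets. -/
def IsFSigma {X : Type*} [TopologicalSpace X] (A : Set X) : Prop :=
  ∃ F : ℕ → Set X, (∀ n, IsClosed (F n)) ∧ A = ⋃ n, F n

/-- A set of reals is a `Q`-set if each of its subsets is relatively `F_σ` in it. -/
def IsQSet (X : Set ℝ) : Prop :=
  ∀ A : Set X, IsFSigma A

/-- The cardinal `𝔮₀`: the least cardinality of a set of reals that is not a `Q`-set. -/
noncomputable def cardinalQ0 : Cardinal.{0} :=
  sInf {κ | ∃ X : Set ℝ, ¬ IsQSet X ∧ #X = κ}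

/-- The cardinal `𝔟`: the least cardinality of a subset of the Baire space `ω^ω` that is not
contained in a `σ`-compact subset of `ω^ω`. -/
noncomputable def cardinalB : Cardinal.{0} :=
  sInf {κ | ∃ B : Set (ℕ → ℕ),
    (¬ ∃ K : Set (ℕ → ℕ), IsSigmaCompact K ∧ B ⊆ K) ∧ #B = κ}

/-- A `σ`-ideal on a set `X`: a family of subsets which covers `X`, does not contain `X`, and
contains every subset of the union of each of its countable subfamilies. -/
structure IsSigmaIdeal {X : Type*} (I : Set (Set X)) : Prop where
  sUnion_eq : ⋃₀ I = Set.univ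
  univ_notMem : Set.univ ∉ I
  mem_of_subset : ∀ S : Set (Set X), S ⊆ I → S.Countable → ∀ A : Set X, A ⊆ ⋃₀ S → A ∈ I

/-- The uniformity `non(I)`: the least cardinality of a subset of `X` outside `I`. -/
noncomputable def nonCard {X : Type*} (I : Set (Set X)) : Cardinal :=
  sInf {κ | ∃ A : Set X, A ∉ I ∧ #A = κ}

/-- The bijection `f` is an automorphism of `I`: `{f(A) : A ∈ I} = I`. -/
def IsIdealAut {X : Type*} (I : Set (Set X)) (f : Equiv.Perm X) : Prop :=
  (fun A : Set X => f '' A) '' I = I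

/-- `I` is `κ`-flexible: any `A`, `B` with `|A ∪ B| < κ` can be made disjoint by an
automorphism of `I`. -/
def IsFlexibleFor {X : Type*} (κ : Cardinal) (I : Set (Set X)) : Prop :=
  ∀ A B : Set X, #(A ∪ B : Set X) < κ →
    ∃ f : Equiv.Perm X, IsIdealAut I f ∧ (f '' A) ∩ B = ∅

/-- `I` is flexible: it is `|X|`-flexible. -/
def IsFlexible {X : Type*} (I : Set (Set X)) : Prop :=
  IsFlexibleFor #X I

/-- The compact countable chain condition: every uncountable disjoint family of compact sets
has a member in `I`. -/
def IsCCCC {X : Type*} [TopologicalSpace X] (I : Set (Set X)) : Prop :=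
  ∀ C : Set (Set X), ¬ C.Countable → C.PairwiseDisjoint id → (∀ K ∈ C, IsCompact K) →
    ∃ K ∈ C, K ∈ I

/-- The countable chain condition: every uncountable disjoint family of Borel sets has a member
in `I`. -/
def IsCCC {X : Type*} [TopologicalSpace X] (I : Set (Set X)) : Prop :=
  ∀ C : Set (Set X), ¬ C.Countable → C.PairwiseDisjoint id →
    (∀ K ∈ C, MeasurableSet[borel X] K) → ∃ K ∈ C, K ∈ I

/-- `I` has a Borel base: each member of `I` lies in a Borel member of `I`. -/
def HasBorelBase {X : Type*} [TopologicalSpace X] (I : Set (Set X)) : Prop :=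
  ∀ A ∈ I, ∃ B ∈ I, MeasurableSet[borel X] B ∧ A ⊆ B

/-- Invariance of `I` under the translations of an additive (abelian) group. -/
def IsTranslationInvariant {G : Type*} [AddCommGroup G] (I : Set (Set G)) : Prop :=
  ∀ g : G, (fun A : Set G => (fun x => g + x) '' A) '' I = I

/-- The intersection of all flexible cccc `σ`-ideals on `X`. -/
def flexibleCCCCIdeal (X : Type*) [TopologicalSpace X] : Set (Set X) :=
  ⋂₀ {I | IsSigmaIdeal I ∧ IsFlexible I ∧ IsCCCC I}

/-- The intersection of all invariant ccc `σ`-ideals with Borel base on `G`. -/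
def invariantCCCIdeal (G : Type*) [TopologicalSpace G] [AddCommGroup G] : Set (Set G) :=
  ⋂₀ {I | IsSigmaIdeal I ∧ IsTranslationInvariant I ∧ IsCCC I ∧ HasBorelBase I}

/-- The ideal `𝓝` of Lebesgue null sets of reals. -/
def lebesgueNullIdeal : Set (Set ℝ) :=
  {A | MeasureTheory.volume A = 0}

/-- The `σ`-ideal `𝓔` generated by the closed Lebesgue null sets of reals: the sets covered by
countably many closed null sets. -/
def closedNullIdeal : Set (Set ℝ) :=
  {A | ∃ F : ℕ → Set ℝ, (∀ n, IsClosed (F n) ∧ MeasureTheory.volume (F n) = 0) ∧ A ⊆ ⋃ n, F n}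

/-- `𝓔` is a `σ`-ideal. -/
theorem isSigmaIdeal_closedNullIdeal : IsSigmaIdeal closedNullIdeal where
  sUnion_eq := by
    refine Set.eq_univ_of_forall fun x => ⟨{x}, ⟨fun _ => {x}, ?_, ?_⟩, rfl⟩
    · intro n
      exact ⟨isClosed_singleton, by simp⟩
    · exact Set.subset_iUnion (fun _ : ℕ => ({x} : Set ℝ)) 0
  univ_notMem := by
    rintro ⟨F, hF, hsub⟩
    have h0 : MeasureTheory.volume (⋃ n, F n) = 0 :=
      MeasureTheory.measure_iUnion_null fun n => (hF n).2
    have h1 := MeasureTheory.measure_mono_null hsub h0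
    simp at h1
  mem_of_subset := by
    intro S hS hc A hA
    rcases S.eq_empty_or_nonempty with rfl | hne
    · refine ⟨fun _ => ∅, fun _ => ⟨isClosed_empty, by simp⟩, ?_⟩
      simpa using hA
    · obtain ⟨s, rfl⟩ := hc.exists_eq_range hne
      choose F hF hsub using fun n => hS (Set.mem_range_self n)
      refine ⟨fun k => F k.unpair.1 k.unpair.2, fun k => hF _ _, fun x hx => ?_⟩
      obtain ⟨_, ⟨n, rfl⟩, hxn⟩ := hA hx
      obtain ⟨m, hm⟩ := Set.mem_iUnion.1 (hsub n hxn)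
      exact Set.mem_iUnion.2 ⟨Nat.pair n m, by simpa using hm⟩

/-- `𝓔` is the least `σ`-ideal containing all closed null sets. -/
theorem closedNullIdeal_subset {I : Set (Set ℝ)} (hI : IsSigmaIdeal I)
    (h : ∀ F : Set ℝ, IsClosed F → MeasureTheory.volume F = 0 → F ∈ I) :
    closedNullIdeal ⊆ I := by
  rintro A ⟨F, hF, hsub⟩
  refine hI.mem_of_subset (Set.range F) ?_ (Set.countable_range F) A ?_
  · rintro _ ⟨n, rfl⟩
    exact h _ (hF n).1 (hF n).2
  · rwa [Set.sUnion_range]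

/-! Lower bound: suppose `I` is a flexible cccc `σ`-ideal and `A ∉ I` has size below `𝔮₀`.
Flexibility gives `ω₁` disjoint copies of `A` under automorphisms of `I`. Their union still has size
below `𝔮₀`, so it is a `Q`-set, and coding the copies by distinct binary sequences places them in
disjoint `F_σδ` sets (`IsQSet.exists_disjoint_enlargement`). Since `𝔮₀ ≤ 𝔟`, each copy is covered by
countably many closed subsets of its `F_σδ` set (`exists_isClosed_cover_of_mk_lt_cardinalB`), and
one compact piece of them lies outside `I`. These `ω₁` disjoint compact sets contradict cccc.

Upper bounds: the sets with `σ`-bounded trace on a suitable copy of the Baire space in `ℝ` form a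
flexible cccc `σ`-ideal, which gives `𝔟`. A Borel isomorphism of the Cantor group with `ℝ` turns
invariant ccc ideals into flexible cccc ones. The Haar null ideal is one such invariant ideal, and
Haar measure is an image of Lebesgue measure on the unit interval. Finally, below `𝔟` the covering
lemma, applied to small open neighbourhoods, puts null sets into `𝓔`. -/

/-! ### Bounded families of functions and `𝔟` -/

/-- A subset of the Baire space is `σ`-bounded if countably many functions suffice to bound each
of its members everywhere. -/
def SigmaBounded (B : Set (ℕ → ℕ)) : Prop :=
  ∃ h : ℕ → ℕ → ℕ, ∀ f ∈ B, ∃ k, ∀ n, f n ≤ h k n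

theorem SigmaBounded.mono {A B : Set (ℕ → ℕ)} (hB : SigmaBounded B) (h : A ⊆ B) :
    SigmaBounded A :=
  let ⟨g, hg⟩ := hB
  ⟨g, fun f hf => hg f (h hf)⟩

theorem sigmaBounded_of_countable {B : Set (ℕ → ℕ)} (hB : B.Countable) : SigmaBounded B := by
  rcases B.eq_empty_or_nonempty with rfl | hne
  · exact ⟨fun _ _ => 0, fun f hf => hf.elim⟩
  · obtain ⟨s, rfl⟩ := hB.exists_eq_range hne
    refine ⟨s, ?_⟩
    rintro _ ⟨k, rfl⟩
    exact ⟨k, fun n => le_rfl⟩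

theorem SigmaBounded.iUnion {B : ℕ → Set (ℕ → ℕ)} (hB : ∀ i, SigmaBounded (B i)) :
    SigmaBounded (⋃ i, B i) := by
  choose h hh using hB
  refine ⟨fun k => h k.unpair.1 k.unpair.2, fun f hf => ?_⟩
  obtain ⟨i, hi⟩ := Set.mem_iUnion.1 hf
  obtain ⟨k, hk⟩ := hh i f hi
  exact ⟨Nat.pair i k, by simpa using hk⟩

theorem not_sigmaBounded_univ : ¬ SigmaBounded Set.univ := by
  rintro ⟨h, hh⟩
  obtain ⟨k, hk⟩ := hh (fun n => h n n + 1) trivial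
  exact absurd (hk k) (by simp)

theorem sigmaBounded_iff {B : Set (ℕ → ℕ)} :
    SigmaBounded B ↔ ∃ K : Set (ℕ → ℕ), IsSigmaCompact K ∧ B ⊆ K := by
  constructor
  · rintro ⟨h, hh⟩
    refine ⟨⋃ k, Set.univ.pi fun n => Set.Iic (h k n), ?_, fun f hf => ?_⟩
    · exact isSigmaCompact_iUnion_of_isCompact _ fun k =>
        isCompact_univ_pi fun n => (Set.finite_Iic _).isCompact
    · obtain ⟨k, hk⟩ := hh f hf
      exact Set.mem_iUnion.2 ⟨k, fun n _ => hk n⟩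
  · rintro ⟨_, ⟨K, hK, rfl⟩, hB⟩
    have hb : ∀ k n, ∃ b, ∀ f ∈ K k, f n ≤ b := fun k n => by
      obtain ⟨b, hb⟩ := ((hK k).image (continuous_apply n)).bddAbove
      exact ⟨b, fun f hf => hb ⟨f, hf, rfl⟩⟩
    choose h hh using hb
    refine ⟨h, fun f hf => ?_⟩
    obtain ⟨k, hk⟩ := Set.mem_iUnion.1 (hB hf)
    exact ⟨k, fun n => hh k n f hk⟩

theorem cardinalB_eq :
    cardinalB = sInf {κ | ∃ B : Set (ℕ → ℕ), ¬ SigmaBounded B ∧ #B = κ} := by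
  simp only [cardinalB, sigmaBounded_iff]

theorem exists_not_sigmaBounded_mk_eq : ∃ B : Set (ℕ → ℕ), ¬ SigmaBounded B ∧ #B = cardinalB := by
  rw [cardinalB_eq]
  exact csInf_mem (s := {κ | ∃ B : Set (ℕ → ℕ), ¬ SigmaBounded B ∧ #B = κ})
    ⟨_, Set.univ, not_sigmaBounded_univ, rfl⟩

theorem sigmaBounded_of_mk_lt {B : Set (ℕ → ℕ)} (hB : #B < cardinalB) : SigmaBounded B := by
  rw [cardinalB_eq] at hB
  by_contra h
  exact notMem_of_lt_csInf' hB ⟨B, h, rfl⟩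

theorem aleph0_lt_cardinalB : ℵ₀ < cardinalB := by
  obtain ⟨B, hB, h⟩ := exists_not_sigmaBounded_mk_eq
  rw [← h]
  by_contra hle
  exact hB (sigmaBounded_of_countable (Cardinal.le_aleph0_iff_set_countable.1 (not_lt.1 hle)))

theorem cardinalB_le_continuum : cardinalB ≤ 𝔠 := by
  obtain ⟨B, -, h⟩ := exists_not_sigmaBounded_mk_eq
  rw [← h]
  exact (Cardinal.mk_set_le B).trans (by simp)

/-- A set of size less than `𝔟` inside an `F_σδ` set is covered by countably many closed subsets
of the latter. -/
theorem exists_isClosed_cover_of_mk_lt_cardinalB {X : Type} [TopologicalSpace X] {A : Set X}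
    (hA : #A < cardinalB) {ι : Type*} [Countable ι] {H : ι → Set X} (hH : ∀ i, IsFSigma (H i))
    (hAH : A ⊆ ⋂ i, H i) :
    ∃ F : ℕ → Set X, (∀ k, IsClosed (F k)) ∧ A ⊆ (⋃ k, F k) ∧ ∀ k, F k ⊆ ⋂ i, H i := by
  obtain ⟨e, he⟩ := exists_injective_nat ι
  choose C hC hCH using hH
  have hmem : ∀ x : A, ∀ i, ∃ m, (x : X) ∈ C i m := fun x i => by
    have := Set.mem_iInter.1 (hAH x.2) i
    rw [hCH] at this
    exact Set.mem_iUnion.1 this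
  choose g hg using hmem
  -- `g x i` names a closed piece of `H i` containing `x`; `e` moves the indices into `ℕ`, and the
  -- value 0 off its range plays no role.
  let G : A → ℕ → ℕ := fun x => Function.extend e (g x) 0
  obtain ⟨h, hh⟩ := sigmaBounded_of_mk_lt (B := Set.range G) (Cardinal.mk_range_le.trans_lt hA)
  -- A bound on the piece numbers leaves finite unions of closed sets, so the intersection is
  -- closed.
  refine ⟨fun k => ⋂ i, ⋃ m ∈ Set.Iic (h k (e i)), C i m, fun k => ?_, fun x hx => ?_, fun k => ?_⟩
  · exact isClosed_iInter fun i => (Set.finite_Iic _).isClosed_biUnion fun m _ => hC i m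
  · obtain ⟨k, hk⟩ := hh _ ⟨⟨x, hx⟩, rfl⟩
    refine Set.mem_iUnion.2 ⟨k, Set.mem_iInter.2 fun i => ?_⟩
    refine Set.mem_biUnion (x := g ⟨x, hx⟩ i) ?_ (hg ⟨x, hx⟩ i)
    simpa [G, he.extend_apply] using hk (e i)
  · refine Set.iInter_mono fun i => ?_
    rw [hCH]
    exact Set.iUnion₂_subset fun m _ => Set.subset_iUnion (C i) m

/-! ### A copy of the Baire space in the real line -/

/-- The set of partial sums of `fun n => f n + 1`, as a sequence of bits. -/
noncomputable def partialSumCode (f : ℕ → ℕ) : ℕ → Bool := fun n =>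
  open Classical in decide (∃ k, ∑ i ∈ Finset.range (k + 1), (f i + 1) = n)

theorem partialSum_strictMono (f : ℕ → ℕ) :
    StrictMono fun k => ∑ i ∈ Finset.range (k + 1), (f i + 1) :=
  strictMono_nat_of_lt_succ fun k => by
    rw [Finset.sum_range_succ _ (k + 1)]
    omega

theorem partialSumCode_eq_true {f : ℕ → ℕ} {n : ℕ} :
    partialSumCode f n = true ↔ ∃ k, ∑ i ∈ Finset.range (k + 1), (f i + 1) = n := by
  simp [partialSumCode]

theorem partialSumCode_zero (f : ℕ → ℕ) : partialSumCode f 0 = false := by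
  rw [← Bool.not_eq_true, partialSumCode_eq_true]
  rintro ⟨k, hk⟩
  rw [Finset.sum_range_succ] at hk
  omega

theorem partialSumCode_injective : Function.Injective partialSumCode := by
  intro f g hfg
  have h : (fun k => ∑ i ∈ Finset.range (k + 1), (f i + 1)) =
      fun k => ∑ i ∈ Finset.range (k + 1), (g i + 1) := by
    refine (StrictMono.range_inj (partialSum_strictMono f) (partialSum_strictMono g)).1 ?_
    ext n
    simp only [Set.mem_range]
    rw [← partialSumCode_eq_true, ← partialSumCode_eq_true, hfg]
  have h' : ∀ k, ∑ i ∈ Finset.range k, (f i + 1) = ∑ i ∈ Finset.range k, (g i + 1) := by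
    rintro (_ | k)
    · simp
    · exact congrFun h k
  funext n
  have h1 := h' (n + 1)
  rw [Finset.sum_range_succ, Finset.sum_range_succ, h' n] at h1
  omega

theorem infinite_partialSumCode (f : ℕ → ℕ) : {n | partialSumCode f n = true}.Infinite := by
  simp only [partialSumCode_eq_true]
  exact Set.infinite_range_of_injective (partialSum_strictMono f).injective

/-- A compact set of codes of infinite sets only bounds the coded functions. -/
theorem exists_bound_of_partialSumCode_mem {C : Set (ℕ → Bool)} (hC : IsCompact C)
    (hinf : ∀ x ∈ C, {n | x n = true}.Infinite) :
    ∃ h : ℕ → ℕ, ∀ f, partialSumCode f ∈ C → ∀ n, f n ≤ h n := by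
  -- Compactness makes the search for the next true bit uniform over `C`.
  have hM : ∀ N, ∃ M, ∀ x ∈ C, ∃ n, N ≤ n ∧ n ≤ M ∧ x n = true := by
    intro N
    have := hC.elim_directed_cover (fun M => {x : ℕ → Bool | ∃ n, N ≤ n ∧ n ≤ M ∧ x n = true})
      (fun M => ?_) (fun x hx => ?_) ?_
    · obtain ⟨M, hM⟩ := this
      exact ⟨M, fun x hx => hM hx⟩
    · simp only [Set.ofPred_exists, Set.ofPred_and]
      refine isOpen_iUnion fun n => isOpen_const.inter (isOpen_const.inter ?_)
      have h : Continuous fun x : ℕ → Bool => x n := continuous_apply n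
      exact (isOpen_discrete ({true} : Set Bool)).preimage h
    · obtain ⟨n, hn, hNn⟩ := (hinf x hx).exists_gt N
      exact Set.mem_iUnion.2 ⟨n, n, hNn.le, le_rfl, hn⟩
    · refine (monotone_nat_of_le_succ fun M => ?_).directed_le
      rintro x ⟨n, h1, h2, h3⟩
      exact ⟨n, h1, h2.trans M.le_succ, h3⟩
  choose M hM using hM
  -- If the `k`-th partial sum `s` is at most `p`, the next one is at most `M (s + 1)`; the range `p
  -- + 2` includes every such `s + 1`.
  let t : ℕ → ℕ := fun k => Nat.rec (M 0) (fun _ p => (Finset.range (p + 2)).sup M) k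
  have ht : ∀ f, partialSumCode f ∈ C → ∀ k, ∑ i ∈ Finset.range (k + 1), (f i + 1) ≤ t k := by
    intro f hf k
    induction k with
    | zero =>
      obtain ⟨n, -, h2, h3⟩ := hM 0 _ hf
      obtain ⟨j, rfl⟩ := partialSumCode_eq_true.1 h3
      exact ((partialSum_strictMono f).monotone (Nat.zero_le j)).trans h2
    | succ k ih =>
      obtain ⟨n, h1, h2, h3⟩ := hM (∑ i ∈ Finset.range (k + 1), (f i + 1) + 1) _ hf
      obtain ⟨j, rfl⟩ := partialSumCode_eq_true.1 h3
      have hkj : k < j := (partialSum_strictMono f).lt_iff_lt.1 (Nat.lt_of_succ_le h1)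
      refine ((partialSum_strictMono f).monotone (Nat.succ_le_of_lt hkj)).trans (h2.trans ?_)
      exact Finset.le_sup (f := M) (Finset.mem_range.2 (Nat.lt_succ_of_le (Nat.succ_le_succ ih)))
  refine ⟨t, fun f hf n => ?_⟩
  have := ht f hf n
  rw [Finset.sum_range_succ] at this
  omega

theorem countable_setOf_finite_true : {x : ℕ → Bool | {n | x n = true}.Finite}.Countable := by
  refine (Set.countable_ofPred_finite_subset (Set.countable_univ (α := ℕ))).preimage_of_injOn
    (f := fun x : ℕ → Bool => {n | x n = true}) ?_ |>.mono ?_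
  · intro x _ y _ h
    funext n
    have : x n = true ↔ y n = true := Set.ext_iff.1 h n
    exact Bool.eq_iff_iff.2 this
  · intro x hx
    exact ⟨hx, Set.subset_univ _⟩

/-- The Baire space embeds into the reals so that closed sets avoiding a fixed countable set
have bounded preimages. -/
theorem exists_injective_baire_real :
    ∃ (ψ : (ℕ → ℕ) → ℝ) (D : Set ℝ), Function.Injective ψ ∧ D.Countable ∧
      (∀ f, ψ f ∉ D) ∧
      (∀ C : Set ℝ, IsClosed C → Disjoint C D → ∃ h : ℕ → ℕ, ∀ f, ψ f ∈ C → ∀ n, f n ≤ h n) ∧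
      #((Set.range ψ)ᶜ : Set ℝ) = 𝔠 := by
  obtain ⟨φ, -, hφ, hinj⟩ :=
    (isClosed_univ (X := ℝ)).exists_nat_bool_injection_of_not_countable Set.not_countable_univ
  -- `D` consists of the images of finite sets: a closed set missing it pulls back to a compact set
  -- of codes of infinite sets.
  refine ⟨φ ∘ partialSumCode, φ '' {x | {n | x n = true}.Finite},
    hinj.comp partialSumCode_injective, countable_setOf_finite_true.image _, ?_, ?_, ?_⟩
  · rintro f ⟨x, hx, hxf⟩
    rw [hinj hxf] at hx
    exact infinite_partialSumCode f hx
  · intro C hC hD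
    refine exists_bound_of_partialSumCode_mem (hC.preimage hφ).isCompact fun x hx hfin => ?_
    exact Set.disjoint_left.1 hD hx ⟨x, hfin, rfl⟩
  · refine le_antisymm ((Cardinal.mk_set_le _).trans Cardinal.mk_real.le) ?_
    -- Bit 0 of every code is false, so sequences starting with true supply continuum many points
    -- off the range.
    have hmem : ∀ y : ℕ → Bool,
        φ (fun n => Nat.casesOn n true y) ∈ (Set.range (φ ∘ partialSumCode))ᶜ := by
      rintro y ⟨f, hf⟩
      have := congrFun (hinj hf) 0
      simp [partialSumCode_zero] at this
    have := Cardinal.mk_le_of_injective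
      (f := fun y : ℕ → Bool => (⟨_, hmem y⟩ : ((Set.range (φ ∘ partialSumCode))ᶜ : Set ℝ)))
      fun y z h => by
        funext n
        exact congrFun (hinj (Subtype.ext_iff.1 h)) (n + 1)
    rwa [show #(ℕ → Bool) = 𝔠 by simp] at this

/-! ### `Q`-sets and `𝔮₀ ≤ 𝔟` -/

theorem cardinalQ0_le_mk {X : Set ℝ} (hX : ¬ IsQSet X) : cardinalQ0 ≤ #X :=
  csInf_le' ⟨X, hX, rfl⟩

theorem isQSet_of_mk_lt {X : Set ℝ} (hX : #X < cardinalQ0) : IsQSet X := by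
  by_contra h
  exact hX.not_ge (cardinalQ0_le_mk h)

/-- Each subset of a `Q`-set is the trace of an `F_σ` set. -/
theorem IsQSet.exists_trace {X : Set ℝ} (hX : IsQSet X) (S : Set ℝ) :
    ∃ C : ℕ → Set ℝ, (∀ m, IsClosed (C m)) ∧ ∀ x ∈ X, x ∈ S ↔ ∃ m, x ∈ C m := by
  obtain ⟨F, hF, hS⟩ := hX (Subtype.val ⁻¹' S)
  choose C hC hCF using fun m => isClosed_induced_iff.1 (hF m)
  refine ⟨C, hC, fun x hx => ?_⟩
  have := Set.ext_iff.1 hS ⟨x, hx⟩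
  simpa [← hCF] using this

/-- Adjoin the countable set `D` to the copy of an unbounded family `B`. Were the union a `Q`-set,
countably many closed sets avoiding `D` would cover the copy of `B`, and each of them bounds its
part of `B`. -/
theorem cardinalQ0_le_cardinalB : cardinalQ0 ≤ cardinalB := by
  obtain ⟨ψ, D, -, hD, hψD, hψ, -⟩ := exists_injective_baire_real
  obtain ⟨B, hB, hBb⟩ := exists_not_sigmaBounded_mk_eq
  have hX : ¬ IsQSet (ψ '' B ∪ D) := by
    intro hX
    obtain ⟨C, hC, hCD⟩ := hX.exists_trace Dᶜ
    have hdis : ∀ m, Disjoint (C m) D := fun m => Set.disjoint_left.2 fun x hx hxD =>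
      (hCD x (Or.inr hxD)).2 ⟨m, hx⟩ hxD
    choose h hh using fun m => hψ (C m) (hC m) (hdis m)
    refine hB ⟨h, fun f hf => ?_⟩
    obtain ⟨m, hm⟩ := (hCD (ψ f) (Or.inl ⟨f, hf, rfl⟩)).1 (hψD f)
    exact ⟨m, hh m f hm⟩
  refine (cardinalQ0_le_mk hX).trans ((Cardinal.mk_union_le _ _).trans ?_)
  refine Cardinal.add_le_of_le aleph0_lt_cardinalB.le (Cardinal.mk_image_le.trans hBb.le) ?_
  exact (Cardinal.le_aleph0_iff_set_countable.2 hD).trans aleph0_lt_cardinalB.le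

/-! ### Flexible cccc ideals contain all sets smaller than `𝔮₀` -/

namespace IsSigmaIdeal

variable {X : Type*} {I : Set (Set X)}

theorem mono (hI : IsSigmaIdeal I) {A B : Set X} (hB : B ∈ I) (h : A ⊆ B) : A ∈ I :=
  hI.mem_of_subset {B} (by simpa) (Set.countable_singleton B) A (by simpa)

theorem iUnion_mem (hI : IsSigmaIdeal I) {ι : Sort*} [Countable ι] {A : ι → Set X}
    (hA : ∀ i, A i ∈ I) : (⋃ i, A i) ∈ I :=
  hI.mem_of_subset (Set.range A) (by rintro _ ⟨i, rfl⟩; exact hA i) (Set.countable_range A) _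
    (by rw [Set.sUnion_range])

theorem singleton_mem (hI : IsSigmaIdeal I) (x : X) : {x} ∈ I := by
  obtain ⟨A, hA, hx⟩ := Set.mem_sUnion.1 (hI.sUnion_eq ▸ Set.mem_univ x)
  exact hI.mono hA (by simpa)

theorem mem_of_countable (hI : IsSigmaIdeal I) {A : Set X} (hA : A.Countable) : A ∈ I := by
  have := hA.to_subtype
  have h := hI.iUnion_mem fun x : A => hI.singleton_mem (x : X)
  rwa [Set.iUnion_of_singleton_coe] at h

end IsSigmaIdeal

theorem IsIdealAut.image_mem_iff {X : Type*} {I : Set (Set X)} {f : Equiv.Perm X}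
    (hf : IsIdealAut I f) {A : Set X} : f '' A ∈ I ↔ A ∈ I := by
  constructor
  · intro h
    rw [← hf] at h
    obtain ⟨B, hB, hBA⟩ := h
    rwa [← f.injective.image_injective hBA]
  · intro h
    rw [← hf]
    exact ⟨A, h, rfl⟩

theorem isIdealAut_of_image_mem {X : Type*} {I : Set (Set X)} {f : Equiv.Perm X}
    (hf : ∀ A ∈ I, f '' A ∈ I) (hf' : ∀ A ∈ I, f ⁻¹' A ∈ I) : IsIdealAut I f := by
  refine Set.Subset.antisymm ?_ fun A hA => ⟨f ⁻¹' A, hf' A hA, f.image_preimage A⟩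
  rintro _ ⟨A, hA, rfl⟩
  exact hf A hA

/-- In a flexible family a set smaller than the whole space has `ω₁` many disjoint copies. -/
theorem IsFlexible.exists_disjoint_copies {X : Type} {I : Set (Set X)} (hI : IsFlexible I)
    {A : Set X} (hA : #A < #X) (hA₀ : ℵ₀ ≤ #A) {W : Type} [LinearOrder W] [WellFoundedLT W]
    (hW : ∀ a : W, (Set.Iio a).Countable) :
    ∃ f : W → Equiv.Perm X, (∀ a, IsIdealAut I (f a)) ∧
      ∀ a b, a ≠ b → Disjoint (f a '' A) (f b '' A) := by
  have step : ∀ (a : W) (ih : ∀ b, b < a → Equiv.Perm X), ∃ f : Equiv.Perm X,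
      IsIdealAut I f ∧ ∀ b (hb : b < a), Disjoint (f '' A) (ih b hb '' A) := by
    intro a ih
    let B : Set X := ⋃ b : Set.Iio a, ih b b.2 '' A
    have hB : #B ≤ #A := by
      refine (Cardinal.mk_iUnion_le _).trans ?_
      refine (mul_le_mul' (Cardinal.le_aleph0_iff_set_countable.2 (hW a))
        (ciSup_le' fun b => Cardinal.mk_image_le)).trans ?_
      exact Cardinal.mul_le_of_le hA₀ hA₀ le_rfl
    obtain ⟨f, hf, hfB⟩ := hI A B <| by
      exact (Cardinal.mk_union_le _ _).trans_lt
        ((Cardinal.add_le_of_le hA₀ le_rfl hB).trans_lt hA)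
    refine ⟨f, hf, fun b hb => ?_⟩
    exact (Set.disjoint_iff_inter_eq_empty.2 hfB).mono_right
      (Set.subset_iUnion (fun b : Set.Iio a => ih b b.2 '' A) ⟨b, hb⟩)
  choose F hF hFd using step
  let f : W → Equiv.Perm X := wellFounded_lt.fix F
  have hf : ∀ a, f a = F a fun b _ => f b := fun a => wellFounded_lt.fix_eq F a
  have hlt : ∀ a b, b < a → Disjoint (f a '' A) (f b '' A) := fun a b hb => by
    rw [hf a]
    exact hFd a _ b hb
  refine ⟨f, fun a => by rw [hf a]; exact hF a _, fun a b hab => ?_⟩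
  rcases lt_or_gt_of_ne hab with h | h
  · exact (hlt b a h).symm
  · exact hlt a b h

/-- A family of at most continuum many disjoint sets with union a `Q`-set can be enlarged to a
disjoint family of `F_σδ` sets. -/
theorem IsQSet.exists_disjoint_enlargement {W : Type} (hW : #W ≤ 𝔠) {A : W → Set ℝ}
    (hA : ∀ a b, a ≠ b → Disjoint (A a) (A b)) (hX : IsQSet (⋃ a, A a)) :
    ∃ H : W → ℕ ⊕ ℕ × ℕ → Set ℝ, (∀ a i, IsFSigma (H a i)) ∧ (∀ a, A a ⊆ ⋂ i, H a i) ∧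
      ∀ a b, a ≠ b → Disjoint (⋂ i, H a i) (⋂ i, H b i) := by
  obtain ⟨⟨c, hc⟩⟩ : Nonempty (W ↪ (ℕ → Bool)) := by
    rw [← Cardinal.le_def]
    simpa using hW
  choose C hC hCX using fun (n : ℕ) (i : Bool) =>
    hX.exists_trace {x | ∃ a, x ∈ A a ∧ c a n = i}
  have key : ∀ a, ∀ x ∈ A a, ∀ n i, c a n = i ↔ ∃ m, x ∈ C n i m := by
    intro a x hx n i
    rw [← hCX n i x (Set.mem_iUnion.2 ⟨a, hx⟩)]
    refine ⟨fun h => ⟨a, hx, h⟩, ?_⟩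
    rintro ⟨b, hb, hi⟩
    by_cases hab : a = b
    · rwa [hab]
    · exact (Set.disjoint_left.1 (hA a b hab) hx hb).elim
  -- For each bit `n`, keep the `F_σ` set of the correct value and remove every closed piece of the
  -- wrong one. Codes differing at `n` then give disjoint intersections, even outside the `Q`-set.
  refine ⟨fun a => Sum.elim (fun n => ⋃ m, C n (c a n) m) fun p => (C p.1 (!c a p.1) p.2)ᶜ,
    ?_, ?_, ?_⟩
  · rintro a (n | ⟨n, m⟩)
    · exact ⟨_, hC n (c a n), rfl⟩
    · obtain ⟨F, hF, -, hFU, -⟩ := (hC n (!c a n) m).isOpen_compl.exists_iUnion_isClosed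
      exact ⟨F, hF, hFU.symm⟩
  · intro a x hx
    refine Set.mem_iInter.2 ?_
    rintro (n | ⟨n, m⟩)
    · exact Set.mem_iUnion.2 ((key a x hx n _).1 rfl)
    · intro hm
      have := (key a x hx n (!c a n)).2 ⟨m, hm⟩
      simp at this
  · intro a b hab
    obtain ⟨n, hn⟩ := Function.ne_iff.1 (hc.ne hab)
    refine Set.disjoint_left.2 fun x hxa hxb => ?_
    obtain ⟨m, hm⟩ := Set.mem_iUnion.1 (Set.mem_iInter.1 hxb (Sum.inl n))
    refine Set.mem_iInter.1 hxa (Sum.inr (n, m)) ?_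
    rwa [show (!c a n) = c b n from Bool.not_eq.2 hn]

theorem mem_flexible_cccc_of_mk_lt {I : Set (Set ℝ)} (hI : IsSigmaIdeal I) (hfl : IsFlexible I)
    (hcc : IsCCCC I) {A : Set ℝ} (hA : #A < cardinalQ0) : A ∈ I := by
  by_contra hAI
  have hA₀ : ℵ₀ < #A := by
    by_contra h
    exact hAI (hI.mem_of_countable (Cardinal.le_aleph0_iff_set_countable.1 (not_lt.1 h)))
  have hAb : #A < cardinalB := hA.trans_le cardinalQ0_le_cardinalB
  have hAc : #A < #ℝ := by
    rw [Cardinal.mk_real]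
    exact hAb.trans_le cardinalB_le_continuum
  -- Order type `ω₁`: uncountable, with countable initial segments as the recursion for disjoint
  -- copies requires.
  let W := (Cardinal.aleph 1).ord.ToType
  have hWmk : #W = Cardinal.aleph 1 := Cardinal.mk_ord_toType _
  have hWle : #W ≤ #A := by
    rw [hWmk, ← Cardinal.succ_aleph0]
    exact Order.succ_le_of_lt hA₀
  have hWc : ∀ a : W, (Set.Iio a).Countable := fun a => by
    rw [← Cardinal.le_aleph0_iff_set_countable, ← Order.lt_succ_iff, Cardinal.succ_aleph0]
    exact (Cardinal.mk_Iio_lt a (by rw [hWmk, Ordinal.type_toType])).trans_eq hWmk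
  obtain ⟨f, hf, hdis⟩ := hfl.exists_disjoint_copies hAc hA₀.le hWc
  have hX : IsQSet (⋃ a, f a '' A) := by
    refine isQSet_of_mk_lt (lt_of_le_of_lt ?_ hA)
    refine (Cardinal.mk_iUnion_le _).trans ?_
    exact (mul_le_mul' hWle (ciSup_le' fun b => Cardinal.mk_image_le)).trans
      (Cardinal.mul_eq_self hA₀.le).le
  obtain ⟨H, hH, hAH, hHd⟩ := hX.exists_disjoint_enlargement
    (hWle.trans (hAc.le.trans Cardinal.mk_real.le)) hdis
  have hK : ∀ a, ∃ K, IsCompact K ∧ K ∉ I ∧ K ⊆ ⋂ i, H a i := by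
    intro a
    obtain ⟨F, hF, hAF, hFH⟩ := exists_isClosed_cover_of_mk_lt_cardinalB
      (Cardinal.mk_image_le.trans_lt hAb) (hH a) (hAH a)
    by_contra! hcon
    -- Cutting the closed sets by balls makes them compact; if all pieces were in `I`, so would be
    -- the copy, and hence `A`.
    refine hAI ((hf a).image_mem_iff.1 (hI.mono (B := ⋃ p : ℕ × ℕ,
      F p.1 ∩ Metric.closedBall 0 p.2) (hI.iUnion_mem fun p => ?_) fun x hx => ?_))
    · by_contra hp
      exact hcon _ ((isCompact_closedBall 0 _).inter_left (hF p.1)) hp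
        (Set.inter_subset_left.trans (hFH p.1))
    · obtain ⟨k, hk⟩ := Set.mem_iUnion.1 (hAF hx)
      obtain ⟨j, hj⟩ := exists_nat_ge (dist x 0)
      exact Set.mem_iUnion.2 ⟨(k, j), hk, hj⟩
  choose K hKc hKI hKH using hK
  have hKd : ∀ a b, a ≠ b → Disjoint (K a) (K b) := fun a b hab =>
    (hHd a b hab).mono (hKH a) (hKH b)
  have hKinj : Function.Injective K := by
    intro a b hab
    by_contra hne
    have := hKd a b hne
    rw [← hab, disjoint_self] at this
    refine hKI a ?_
    rw [this]
    exact hI.mem_of_countable Set.countable_empty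
  have hunc : ¬ (Set.range K).Countable := by
    rw [← Cardinal.le_aleph0_iff_set_countable, Cardinal.mk_range_eq K hKinj, hWmk, not_le]
    exact Cardinal.aleph0_lt_aleph_one
  have hpd : (Set.range K).PairwiseDisjoint id := by
    rintro _ ⟨a, rfl⟩ _ ⟨b, rfl⟩ hab
    exact hKd a b fun h => hab (by rw [h])
  obtain ⟨_, ⟨a, rfl⟩, ha⟩ := hcc (Set.range K) hunc hpd (Set.forall_mem_range.2 hKc)
  exact hKI a ha

/-! ### A flexible cccc ideal witnessing the bound `𝔟` -/

theorem nonCard_le_mk {X : Type} {I : Set (Set X)} {A : Set X} (hA : A ∉ I) : nonCard I ≤ #A :=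
  csInf_le' ⟨A, hA, rfl⟩

theorem le_nonCard {X : Type} {I : Set (Set X)} {κ : Cardinal.{0}} (hI : Set.univ ∉ I)
    (h : ∀ A ∉ I, κ ≤ #A) : κ ≤ nonCard I := by
  refine le_csInf ⟨_, Set.univ, hI, rfl⟩ ?_
  rintro _ ⟨A, hA, rfl⟩
  exact h A hA

/-- A large enough family of automorphisms without coincidences witnesses flexibility. -/
theorem isFlexible_of_injective_action {X G : Type} {I : Set (Set X)} [Infinite X]
    (hG : #X ≤ #G) (act : G → Equiv.Perm X) (hact : ∀ g, IsIdealAut I (act g))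
    (hinj : ∀ x, Function.Injective fun g => act g x) : IsFlexible I := by
  intro A B hAB
  by_contra! hcon
  have hg : ∀ g, ∃ a : A, ∃ b : B, act g a = b := by
    intro g
    obtain ⟨_, ⟨a, ha, rfl⟩, hb⟩ := hcon (act g) (hact g)
    exact ⟨⟨a, ha⟩, ⟨_, hb⟩, rfl⟩
  choose a b hab using hg
  -- If no `act g` separates `A` from `B`, each `g` sends some `a g` to `b g` and is determined by
  -- this pair, which is too few elements.
  have h1 : #G ≤ #(A × B) := Cardinal.mk_le_of_injective (f := fun g => (a g, b g)) <| by
    intro g g' h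
    obtain ⟨h1, h2⟩ := Prod.ext_iff.1 h
    refine hinj (a g) ?_
    change act g (a g) = act g' (a g)
    rw [hab, show a g = a g' from h1, hab, show b g = b g' from h2]
  rw [Cardinal.mk_prod, Cardinal.lift_id, Cardinal.lift_id] at h1
  refine (hG.trans h1).not_gt (Cardinal.mul_lt_of_lt (Cardinal.aleph0_le_mk X) ?_ ?_)
  · exact (Cardinal.mk_le_mk_of_subset Set.subset_union_left).trans_lt hAB
  · exact (Cardinal.mk_le_mk_of_subset Set.subset_union_right).trans_lt hAB

/-- The permutation of the Baire space given by bitwise addition of `g`. -/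
def xorPerm (g : ℕ → ℕ) : Equiv.Perm (ℕ → ℕ) where
  toFun f n := f n ^^^ g n
  invFun f n := f n ^^^ g n
  left_inv f := by funext n; simp
  right_inv f := by funext n; simp

theorem SigmaBounded.preimage_xorPerm {B : Set (ℕ → ℕ)} (hB : SigmaBounded B) (g : ℕ → ℕ) :
    SigmaBounded (xorPerm g ⁻¹' B) := by
  obtain ⟨h, hh⟩ := hB
  refine ⟨fun k n => (Finset.range (h k n + 1)).sup fun m => m ^^^ g n, fun f hf => ?_⟩
  obtain ⟨k, hk⟩ := hh _ hf
  refine ⟨k, fun n => ?_⟩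
  have := Finset.le_sup (f := fun m => m ^^^ g n) (Finset.mem_range.2 (Nat.lt_succ_of_le (hk n)))
  simpa [xorPerm, Nat.xor_assoc] using this

/-- Bitwise addition acts freely on the Baire space and preserves `σ`-boundedness, whence
flexibility. For cccc, only countably many disjoint sets can meet `D`, and a compact set missing `D`
has bounded trace. -/
theorem exists_flexible_cccc_ideal_of_sigmaBounded :
    ∃ (ψ : (ℕ → ℕ) → ℝ), Function.Injective ψ ∧
      IsSigmaIdeal {A : Set ℝ | SigmaBounded (ψ ⁻¹' A)} ∧
      IsFlexible {A : Set ℝ | SigmaBounded (ψ ⁻¹' A)} ∧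
      IsCCCC {A : Set ℝ | SigmaBounded (ψ ⁻¹' A)} := by
  obtain ⟨ψ, D, hψ, hD, hψD, hb, hcard⟩ := exists_injective_baire_real
  refine ⟨ψ, hψ, ⟨?_, ?_, ?_⟩, ?_, ?_⟩
  · refine Set.eq_univ_of_forall fun x => Set.mem_sUnion.2 ⟨{x}, ?_, rfl⟩
    exact sigmaBounded_of_countable ((Set.countable_singleton x).preimage_of_injOn hψ.injOn)
  · exact not_sigmaBounded_univ
  · intro S hS hSc A hA
    rcases S.eq_empty_or_nonempty with rfl | hne
    · have : A = ∅ := by simpa using hA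
      subst this
      exact sigmaBounded_of_countable (by simp)
    · obtain ⟨s, rfl⟩ := hSc.exists_eq_range hne
      refine (SigmaBounded.iUnion fun i => hS ⟨i, rfl⟩).mono fun f hf => ?_
      obtain ⟨_, ⟨i, rfl⟩, hi⟩ := hA hf
      exact Set.mem_iUnion.2 ⟨i, hi⟩
  · obtain ⟨e⟩ : Nonempty ((ℕ → ℕ) ≃ ((Set.range ψ)ᶜ : Set ℝ)) :=
      Cardinal.eq.1 (by rw [hcard]; simp)
    -- The complement of the copy, also of size continuum, is made a second copy so that the action
    -- is free on all of `ℝ`; the ideal ignores this part.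
    let E : (ℕ → ℕ) ⊕ (ℕ → ℕ) ≃ ℝ := by
      classical
      exact (Equiv.sumCongr (Equiv.ofInjective ψ hψ) e).trans (Equiv.Set.sumCompl (Set.range ψ))
    have hE : ∀ f, E (Sum.inl f) = ψ f := fun f => rfl
    let act : (ℕ → ℕ) → Equiv.Perm ℝ := fun g =>
      (E.symm.trans (Equiv.sumCongr (xorPerm g) (xorPerm g))).trans E
    have hactψ : ∀ g f, act g (ψ f) = ψ (xorPerm g f) := fun g f => by
      simp [act, ← hE]
    have hxx : ∀ g f, xorPerm g (xorPerm g f) = f := fun g f => (xorPerm g).left_inv f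
    have hact2 : ∀ g x, act g (act g x) = x := fun g x => by
      obtain ⟨y, rfl⟩ := E.surjective x
      rcases y with y | y <;> simp [act, hxx]
    have hpre : ∀ g, ∀ A : Set ℝ, SigmaBounded (ψ ⁻¹' A) →
        SigmaBounded (ψ ⁻¹' (act g ⁻¹' A)) := fun g A hA =>
      (hA.preimage_xorPerm g).mono fun f hf => by
        simpa [hactψ] using hf
    refine isFlexible_of_injective_action (G := ℕ → ℕ) ?_ act (fun g => ?_) fun x g g' h => ?_
    · simp [Cardinal.mk_real]
    · refine isIdealAut_of_image_mem (fun A hA => ?_) (hpre g)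
      refine (hpre g A hA).mono ?_
      rintro f ⟨x, hx, hxf⟩
      change act g (ψ f) ∈ A
      rwa [← hxf, hact2]
    · obtain ⟨y, rfl⟩ := E.surjective x
      have hx : ∀ y, xorPerm g y = xorPerm g' y → g = g' := fun y h => by
        funext n
        exact Nat.xor_right_inj.1 (congrFun h n)
      rcases y with y | y
      · refine hx y ?_
        simpa [act] using h
      · refine hx y ?_
        simpa [act] using h
  · intro C hC hCd hCc
    have hnc : ∃ K ∈ C, Disjoint K D := by
      by_contra! hcon
      choose! d hd using fun K hK => Set.not_disjoint_iff.1 (hcon K hK)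
      refine hC (Set.MapsTo.countable_of_injOn (f := d) (t := D) (fun K hK => (hd K hK).2) ?_ hD)
      intro K hK L hL hKL
      by_contra hne
      exact Set.disjoint_left.1 (hCd hK hL hne) (hd K hK).1 (hKL ▸ (hd L hL).1)
    obtain ⟨K, hK, hKD⟩ := hnc
    obtain ⟨h, hh⟩ := hb K (hCc K hK).isClosed hKD
    exact ⟨K, hK, fun _ => h, fun f hf => ⟨0, hh f hf⟩⟩

theorem exists_notMem_flexibleCCCCIdeal_mk_le :
    ∃ A : Set ℝ, A ∉ flexibleCCCCIdeal ℝ ∧ #A ≤ cardinalB := by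
  obtain ⟨ψ, hψ, h1, h2, h3⟩ := exists_flexible_cccc_ideal_of_sigmaBounded
  obtain ⟨B, hB, hBb⟩ := exists_not_sigmaBounded_mk_eq
  refine ⟨ψ '' B, fun hmem => hB ?_, Cardinal.mk_image_le.trans hBb.le⟩
  have : SigmaBounded (ψ ⁻¹' (ψ '' B)) := Set.mem_sInter.1 hmem _ ⟨h1, h2, h3⟩
  rwa [Set.preimage_image_eq _ hψ] at this

theorem nonCard_flexibleCCCCIdeal_le_cardinalB : nonCard (flexibleCCCCIdeal ℝ) ≤ cardinalB := by
  obtain ⟨A, hA, hAb⟩ := exists_notMem_flexibleCCCCIdeal_mk_le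
  exact (nonCard_le_mk hA).trans hAb

theorem cardinalQ0_le_nonCard_flexibleCCCCIdeal :
    cardinalQ0 ≤ nonCard (flexibleCCCCIdeal ℝ) := by
  obtain ⟨A, hA, -⟩ := exists_notMem_flexibleCCCCIdeal_mk_le
  refine le_csInf ⟨_, A, hA, rfl⟩ ?_
  rintro _ ⟨B, hB, rfl⟩
  by_contra! hlt
  refine hB (Set.mem_sInter.2 ?_)
  rintro I ⟨h1, h2, h3⟩
  exact mem_flexible_cccc_of_mk_lt h1 h2 h3 hlt

/-! ### Invariant ccc ideals on the Cantor group -/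

theorem mk_nat_arrow_zmod_two : #(ℕ → ZMod 2) = 𝔠 := by
  simp

/-- Translations form a free action of a group of size continuum, so flexibility survives transport
by any bijection. Measurability of `e` suffices for the chain condition, as compact sets pull back
to Borel sets. -/
theorem exists_invariant_ccc_ideal_transfer {J : Set (Set (ℕ → ZMod 2))} (hJ : IsSigmaIdeal J)
    (hinv : IsTranslationInvariant J) (hccc : IsCCC J) (e : (ℕ → ZMod 2) ≃ᵐ ℝ) :
    IsSigmaIdeal {A : Set ℝ | e ⁻¹' A ∈ J} ∧ IsFlexible {A : Set ℝ | e ⁻¹' A ∈ J} ∧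
      IsCCCC {A : Set ℝ | e ⁻¹' A ∈ J} := by
  refine ⟨⟨?_, ?_, ?_⟩, ?_, ?_⟩
  · refine Set.eq_univ_of_forall fun x => Set.mem_sUnion.2 ⟨{x}, ?_, rfl⟩
    exact hJ.mem_of_countable ((Set.countable_singleton x).preimage_of_injOn e.injective.injOn)
  · exact hJ.univ_notMem
  · intro S hS hSc A hA
    refine hJ.mem_of_subset ((fun B => e ⁻¹' B) '' S) ?_ (hSc.image _) _ ?_
    · rintro _ ⟨B, hB, rfl⟩
      exact hS hB
    · rw [Set.sUnion_image, ← Set.preimage_iUnion₂, ← Set.sUnion_eq_biUnion]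
      exact Set.preimage_mono hA
  · have htr : ∀ g, ∀ B ∈ J, (fun x => g + x) '' B ∈ J := fun g B hB => by
      rw [← hinv g]
      exact ⟨B, hB, rfl⟩
    refine isFlexible_of_injective_action (G := ℕ → ZMod 2) ?_
      (fun g => (e.symm.toEquiv.trans (Equiv.addLeft g)).trans e.toEquiv) (fun g => ?_)
      fun x g g' h => ?_
    · rw [mk_nat_arrow_zmod_two, Cardinal.mk_real]
    · refine isIdealAut_of_image_mem (fun A hA => ?_) fun A hA => ?_
      · refine hJ.mono (htr g _ hA) ?_
        rintro y ⟨x, hx, hxy⟩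
        refine ⟨e.symm x, by simpa using hx, ?_⟩
        exact e.injective hxy
      · refine hJ.mono (htr (-g) _ hA) ?_
        intro y hy
        refine ⟨g + y, ?_, by simp⟩
        simpa using hy
    · simpa using h
  · intro C hC hCd hCc
    have hunc : ¬ ((fun B => e ⁻¹' B) '' C).Countable := fun h =>
      hC (Set.countable_of_injective_of_countable_image e.surjective.preimage_injective.injOn h)
    have hpd : ((fun B => e ⁻¹' B) '' C).PairwiseDisjoint id := by
      rintro _ ⟨K, hK, rfl⟩ _ ⟨L, hL, rfl⟩ hne
      exact (hCd hK hL fun h => hne (by rw [h])).preimage e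
    obtain ⟨_, ⟨K, hK, rfl⟩, hKJ⟩ := hccc _ hunc hpd <| by
      rintro _ ⟨K, hK, rfl⟩
      rw [← BorelSpace.measurable_eq]
      exact e.measurable (hCc K hK).measurableSet
    exact ⟨K, hK, hKJ⟩

theorem haar_null_ideal_properties (μ : MeasureTheory.Measure (ℕ → ZMod 2)) [μ.IsAddHaarMeasure] :
    IsSigmaIdeal {A | μ A = 0} ∧ IsTranslationInvariant {A | μ A = 0} ∧ IsCCC {A | μ A = 0} ∧
      HasBorelBase {A | μ A = 0} := by
  refine ⟨⟨?_, ?_, ?_⟩, ?_, ?_, ?_⟩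
  · refine Set.eq_univ_of_forall fun x => Set.mem_sUnion.2 ⟨{x}, ?_, rfl⟩
    have hc := MeasureTheory.Measure.countable_meas_pos_of_disjoint_iUnion (μ := μ)
      (As := fun x : ℕ → ZMod 2 => {x}) (fun x => MeasurableSet.singleton x)
      (fun x y hne => Set.disjoint_singleton.2 hne)
    -- At most countably many points have positive mass, so some point is null, and translation
    -- makes every point null.
    obtain ⟨y, hy⟩ : ∃ y, μ {y} = 0 := by
      by_contra! hcon
      have huniv : {y | 0 < μ {y}} = Set.univ :=
        Set.eq_univ_of_forall fun y => pos_iff_ne_zero.2 (hcon y)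
      rw [huniv, ← Cardinal.le_aleph0_iff_set_countable, Cardinal.mk_univ,
        mk_nat_arrow_zmod_two] at hc
      exact hc.not_gt Cardinal.aleph0_lt_continuum
    have hxy : (fun z => (x - y) + z) '' {y} = {x} := by simp
    change μ {x} = 0
    rw [← hxy, Set.image_add_left, MeasureTheory.measure_preimage_add, hy]
  · exact NeZero.ne (μ Set.univ)
  · intro S hS hSc A hA
    exact MeasureTheory.measure_mono_null hA ((MeasureTheory.measure_sUnion_null_iff hSc).2 hS)
  · intro g
    refine Set.Subset.antisymm ?_ fun A hA => ?_
    · rintro _ ⟨A, hA, rfl⟩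
      change μ _ = 0
      rw [← hA]
      simp
    · refine ⟨(fun x => -g + x) '' A, ?_, by
        simp only [Set.image_image, add_neg_cancel_left, Set.image_id']⟩
      change μ _ = 0
      rw [← hA]
      simp
  · intro C hC hCd hCc
    by_contra! hcon
    have hc := MeasureTheory.Measure.countable_meas_pos_of_disjoint_iUnion (μ := μ)
      (As := fun K : C => (K : Set (ℕ → ZMod 2)))
      (fun K => by rw [BorelSpace.measurable_eq (α := ℕ → ZMod 2)]; exact hCc K K.2)
      (fun K L hne => hCd K.2 L.2 (Subtype.coe_injective.ne hne))
    have huniv : {K : C | 0 < μ (K : Set (ℕ → ZMod 2))} = Set.univ :=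
      Set.eq_univ_of_forall fun K => pos_iff_ne_zero.2 (hcon K K.2)
    rw [huniv, Set.countable_univ_iff] at hc
    exact hC hc
  · intro A hA
    refine ⟨MeasureTheory.toMeasurable μ A, ?_, ?_, MeasureTheory.subset_toMeasurable μ A⟩
    · exact (MeasureTheory.measure_toMeasurable A).trans hA
    · rw [← BorelSpace.measurable_eq]
      exact MeasureTheory.measurableSet_toMeasurable μ A

/-- Some probability measure on the Cantor group has an invariant ccc null ideal with Borel
base. -/
theorem exists_probability_invariant_ccc :
    ∃ μ : MeasureTheory.Measure (ℕ → ZMod 2), MeasureTheory.IsProbabilityMeasure μ ∧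
      IsSigmaIdeal {A | μ A = 0} ∧ IsTranslationInvariant {A | μ A = 0} ∧
      IsCCC {A | μ A = 0} ∧ HasBorelBase {A | μ A = 0} :=
  ⟨MeasureTheory.Measure.addHaarMeasure ⊤, ⟨MeasureTheory.Measure.addHaarMeasure_self⟩,
    haar_null_ideal_properties _⟩

theorem univ_notMem_invariantCCCIdeal : Set.univ ∉ invariantCCCIdeal (ℕ → ZMod 2) := by
  obtain ⟨μ, -, hμ⟩ := exists_probability_invariant_ccc
  exact fun h => hμ.1.univ_notMem (Set.mem_sInter.1 h _ hμ)

theorem nonCard_flexibleCCCCIdeal_le_nonCard_invariantCCCIdeal :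
    nonCard (flexibleCCCCIdeal ℝ) ≤ nonCard (invariantCCCIdeal (ℕ → ZMod 2)) := by
  refine le_nonCard univ_notMem_invariantCCCIdeal fun A hA => ?_
  obtain ⟨J, ⟨h1, h2, h3, -⟩, hAJ⟩ : ∃ J : Set (Set (ℕ → ZMod 2)),
      (IsSigmaIdeal J ∧ IsTranslationInvariant J ∧ IsCCC J ∧ HasBorelBase J) ∧ A ∉ J := by
    by_contra! h
    exact hA (Set.mem_sInter.2 h)
  have hunc : ¬ Countable (ℕ → ZMod 2) := by
    rw [← Cardinal.mk_le_aleph0_iff, mk_nat_arrow_zmod_two, not_le]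
    exact Cardinal.aleph0_lt_continuum
  have hunc' : ¬ Countable ℝ := fun h => Set.not_countable_univ (Set.to_countable (Set.univ : Set ℝ))
  let e : (ℕ → ZMod 2) ≃ᵐ ℝ := PolishSpace.measurableEquivOfNotCountable hunc hunc'
  have hI := exists_invariant_ccc_ideal_transfer h1 h2 h3 e
  refine (nonCard_le_mk (A := e '' A) fun hmem => hAJ ?_).trans Cardinal.mk_image_le
  have : e ⁻¹' (e '' A) ∈ J := Set.mem_sInter.1 hmem _ hI
  rwa [Set.preimage_image_eq _ e.injective] at this

/-! ### Comparison with Lebesgue null sets and with `𝓔` -/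

theorem univ_notMem_lebesgueNullIdeal : Set.univ ∉ lebesgueNullIdeal := by
  simp [lebesgueNullIdeal]

/-- A non-null set of reals has a translate with non-null trace on the unit interval. -/
theorem exists_translate_unitInterval_ne_zero {A : Set ℝ} (hA : MeasureTheory.volume A ≠ 0) :
    ∃ r : ℝ, MeasureTheory.volume {t : unitInterval | r + t ∈ A} ≠ 0 := by
  by_contra! h
  refine hA (MeasureTheory.measure_mono_null (t := ⋃ n : ℤ, A ∩ Set.Icc (n : ℝ) (n + 1)) ?_
    (MeasureTheory.measure_iUnion_null fun n => ?_))
  · intro x hx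
    exact Set.mem_iUnion.2 ⟨⌊x⌋, hx, Int.floor_le x, (Int.lt_floor_add_one x).le⟩
  · have h0 := h n
    have hemb : MeasurableEmbedding ((↑) : unitInterval → ℝ) :=
      MeasurableEmbedding.subtype_coe measurableSet_Icc
    rw [unitInterval.volume_def, hemb.comap_apply] at h0
    rw [← MeasureTheory.measure_preimage_add MeasureTheory.volume (n : ℝ)]
    refine MeasureTheory.measure_mono_null ?_ h0
    rintro t ⟨ht, h1, h2⟩
    exact ⟨⟨t, by simpa using h1, by linarith⟩, ht, rfl⟩

theorem nonCard_invariantCCCIdeal_le_nonCard_lebesgueNullIdeal :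
    nonCard (invariantCCCIdeal (ℕ → ZMod 2)) ≤ nonCard lebesgueNullIdeal := by
  refine le_nonCard univ_notMem_lebesgueNullIdeal fun A hA => ?_
  obtain ⟨μ, hp, hμ⟩ := exists_probability_invariant_ccc
  -- `μ` is the image of Lebesgue measure on the unit interval under `f`. Injectivity of `f` is not
  -- needed: if `f '' T` were null, its preimage, which contains `T`, would be null.
  obtain ⟨f, hf, hfμ⟩ := μ.exists_measurable_map_eq
  obtain ⟨r, hr⟩ := exists_translate_unitInterval_ne_zero hA
  let T : Set unitInterval := {t | r + t ∈ A}
  have hTA : #T ≤ #A := Cardinal.mk_le_of_injective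
    (f := fun t : T => (⟨r + t, t.2⟩ : A)) fun s t h => by
      simpa [Subtype.ext_iff] using h
  refine (nonCard_le_mk (A := f '' T) fun hmem => hr ?_).trans (Cardinal.mk_image_le.trans hTA)
  have h0 : μ (f '' T) = 0 := Set.mem_sInter.1 hmem _ hμ
  rw [← hfμ] at h0
  exact MeasureTheory.measure_mono_null (Set.subset_preimage_image f T)
    (MeasureTheory.Measure.preimage_null_of_map_null hf.aemeasurable h0)

theorem closedNullIdeal_subset_lebesgueNullIdeal : closedNullIdeal ⊆ lebesgueNullIdeal := by
  rintro A ⟨F, hF, hA⟩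
  exact MeasureTheory.measure_mono_null hA (MeasureTheory.measure_iUnion_null fun n => (hF n).2)

theorem nonCard_closedNullIdeal_le_nonCard_lebesgueNullIdeal :
    nonCard closedNullIdeal ≤ nonCard lebesgueNullIdeal :=
  le_nonCard univ_notMem_lebesgueNullIdeal fun _ hA =>
    nonCard_le_mk fun h => hA (closedNullIdeal_subset_lebesgueNullIdeal h)

/-- A Lebesgue null set of size less than `𝔟` is covered by countably many closed null sets. -/
theorem mem_closedNullIdeal_of_mk_lt_cardinalB {A : Set ℝ} (hA : A ∈ lebesgueNullIdeal)
    (hAb : #A < cardinalB) : A ∈ closedNullIdeal := by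
  have hU : ∀ n : ℕ, ∃ U ⊇ A, IsOpen U ∧ MeasureTheory.volume U < ((n : ENNReal) + 1)⁻¹ := by
    intro n
    refine A.exists_isOpen_lt_of_lt _ ?_
    rw [show MeasureTheory.volume A = 0 from hA]
    simp
  choose U hAU hUo hUv using hU
  -- The closed sets lie in every `U n`, hence are null.
  obtain ⟨F, hF, hAF, hFU⟩ := exists_isClosed_cover_of_mk_lt_cardinalB hAb (H := U) (fun n => by
    obtain ⟨F, hF, -, hFU, -⟩ := (hUo n).exists_iUnion_isClosed
    exact ⟨F, hF, hFU.symm⟩) (Set.subset_iInter hAU)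
  refine ⟨F, fun k => ⟨hF k, ?_⟩, hAF⟩
  by_contra hne
  obtain ⟨n, hn⟩ := ENNReal.exists_inv_nat_lt hne
  have h1 : MeasureTheory.volume (F k) ≤ MeasureTheory.volume (U n) :=
    MeasureTheory.measure_mono ((hFU k).trans (Set.iInter_subset U n))
  have h2 : ((n : ENNReal) + 1)⁻¹ ≤ (n : ENNReal)⁻¹ := ENNReal.inv_le_inv.2 le_self_add
  exact (((h1.trans_lt (hUv n)).trans_le h2).trans hn).false

theorem min_cardinalB_nonCard_lebesgueNullIdeal_le :
    min cardinalB (nonCard lebesgueNullIdeal) ≤ nonCard closedNullIdeal := by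
  refine le_nonCard isSigmaIdeal_closedNullIdeal.univ_notMem fun A hA => ?_
  by_contra! hlt
  obtain ⟨h1, h2⟩ := lt_min_iff.1 hlt
  refine hA (mem_closedNullIdeal_of_mk_lt_cardinalB ?_ h1)
  by_contra hN
  exact h2.not_ge (nonCard_le_mk hN)

theorem mainTheorem4 :
    cardinalQ0 ≤ nonCard (flexibleCCCCIdeal ℝ) ∧
    nonCard (flexibleCCCCIdeal ℝ) ≤
      min cardinalB (nonCard (invariantCCCIdeal (ℕ → ZMod 2))) ∧
    min cardinalB (nonCard (invariantCCCIdeal (ℕ → ZMod 2))) ≤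
      min cardinalB (nonCard lebesgueNullIdeal) ∧
    min cardinalB (nonCard lebesgueNullIdeal) = min cardinalB (nonCard closedNullIdeal) :=
  ⟨cardinalQ0_le_nonCard_flexibleCCCCIdeal,
    le_min nonCard_flexibleCCCCIdeal_le_cardinalB
      nonCard_flexibleCCCCIdeal_le_nonCard_invariantCCCIdeal,
    min_le_min_left _ nonCard_invariantCCCIdeal_le_nonCard_lebesgueNullIdeal,
    le_antisymm (le_min (min_le_left _ _) min_cardinalB_nonCard_lebesgueNullIdeal_le)
      (min_le_min_left _ nonCard_closedNullIdeal_le_nonCard_lebesgueNullIdeal)⟩
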